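/- Let $\alpha>0$ and let $\xi_{(\alpha)}$ be a real random variable whose law is characterized by its Laplace transform $$\mathbb E\big[\exp(\lambda\,\xi_{(\alpha)})\big]=\exp\big(\phi_{(\alpha)}(\lambda)\big)<\infty,\qquad \lambda\in\mathbb R,\qquad\text{where}\quad \phi_{(\alpha)}(\lambda)=\frac{\alpha+1}{\alpha}\int_0^1\big(e^{\lambda u}-1\big)\,\frac{1-u}{u}\,\mathrm du .$$ For each $n\ge 1$ let $\xi_{(\alpha,1)},\dots,\xi_{(\alpha,n)}$ be i.i.d. copies of $\xi_{(\alpha)}$ (the family may depend on $n$; in particular, they may be the first $n$ terms of one i.i.d. sequence). Then $$\frac{\max\{\xi_{(\alpha,1)},\dots,\xi_{(\alpha,n)}\}\cdot\ln(\ln n)}{\ln n}\ \longrightarrow\ 1\qquad\text{in probability as } n\to\infty .$$ -/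

import Mathlib

open MeasureTheory ProbabilityTheory Filter

/-- The Laplace exponent
`φ_α(l) = (α + 1) / α * ∫_0^1 (exp (l u) - 1) (1 - u) / u du`. -/
noncomputable def xiExponent (α l : ℝ) : ℝ :=
  (α + 1) / α * ∫ u in (0 : ℝ)..1, (Real.exp (l * u) - 1) * ((1 - u) / u)

/-- `ν` is the law of `ξ_(α)`: the probability measure on the real line whose (two-sided) Laplace
transform is finite everywhere and equals `exp (φ_α(l))` at every real `l`. -/
structure IsXiLaw (α : ℝ) (ν : Measure ℝ) : Prop where
  isProbabilityMeasure : IsProbabilityMeasure ν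
  integrable_exp : ∀ l : ℝ, Integrable (fun x : ℝ => Real.exp (l * x)) ν
  mgf_eq : ∀ l : ℝ, mgf id ν l = Real.exp (xiExponent α l)

/-! Put `x = log n / log log n`. By the union bound and by independence it suffices that `n * P(ξ ≥
(1 + ε) x) → 0` and `n * P(ξ > (1 - ε) x) → ∞`. Both rest on the Laplace exponent φ growing like
`exp l` up to powers of `l`. Upper tail (`tendsto_mul_measureReal_ge`): Chernoff with `φ l ≤ C * exp
l`, at `l` slightly below `log log n`. Lower tail (`tendsto_mul_measureReal_gt`): tilt by `l` so
that the mean `φ' l` is of order `x`. Since `φ'' ≤ 2 φ'`, Chebyshev concentrates the tilted law near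
its mean, and undoing the tilt costs about `exp (-l * φ' l)`, with `l` at most slightly above `log
log n`. -/

/-! ### The Laplace exponent and its derivatives -/

/-- For `l ≠ 0` this is the derivative of `xiExponent α` at `l`. -/
noncomputable def xiSlope (α l : ℝ) : ℝ :=
  (α + 1) / α * ((Real.exp l - 1 - l) / l ^ 2)

lemma xiIntegrand_nonneg {l u : ℝ} (hl : 0 ≤ l) (hu : 0 ≤ u) (hu1 : u ≤ 1) :
    0 ≤ (Real.exp (l * u) - 1) * ((1 - u) / u) := by
  have h : 1 ≤ Real.exp (l * u) := Real.one_le_exp (by positivity)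
  exact mul_nonneg (by linarith) (div_nonneg (by linarith) hu)

lemma xiIntegrand_le {l u : ℝ} (hl : 0 ≤ l) (hu : 0 ≤ u) (hu1 : u ≤ 1) :
    (Real.exp (l * u) - 1) * ((1 - u) / u) ≤ Real.exp l := by
  rcases hu.eq_or_lt with rfl | hu0
  · simpa using (Real.exp_pos l).le
  -- The chord of exp over `[0, l]` supplies a factor `u` that cancels `1 / u`.
  have hconv : Real.exp (l * u) - 1 ≤ u * (Real.exp l - 1) := by
    have h := convexOn_exp.2 (Set.mem_univ l) (Set.mem_univ 0) hu (sub_nonneg.2 hu1) (by ring)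
    simp only [smul_eq_mul, mul_zero, add_zero, Real.exp_zero, mul_one] at h
    rw [mul_comm l u]
    linarith
  have h1 : 1 ≤ Real.exp l := Real.one_le_exp hl
  calc (Real.exp (l * u) - 1) * ((1 - u) / u)
      ≤ u * (Real.exp l - 1) * ((1 - u) / u) :=
        mul_le_mul_of_nonneg_right hconv (div_nonneg (by linarith) hu)
    _ = (Real.exp l - 1) * (1 - u) := by field_simp
    _ ≤ Real.exp l := by nlinarith

lemma intervalIntegrable_xiIntegrand {l : ℝ} (hl : 0 ≤ l) :
    IntervalIntegrable (fun u : ℝ => (Real.exp (l * u) - 1) * ((1 - u) / u)) volume 0 1 := by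
  refine (intervalIntegrable_const (c := Real.exp l)).mono_fun
    (by fun_prop) ?_
  rw [EventuallyLE, ae_restrict_iff' measurableSet_uIoc]
  refine ae_of_all _ fun u hu => ?_
  rw [Set.uIoc_of_le zero_le_one] at hu
  rw [Real.norm_of_nonneg (xiIntegrand_nonneg hl hu.1.le hu.2),
    Real.norm_of_nonneg (Real.exp_pos l).le]
  exact xiIntegrand_le hl hu.1.le hu.2

lemma xiExponent_nonneg {α l : ℝ} (hα : 0 < α) (hl : 0 ≤ l) : 0 ≤ xiExponent α l :=
  mul_nonneg (by positivity)
    (intervalIntegral.integral_nonneg zero_le_one fun _ hu => xiIntegrand_nonneg hl hu.1 hu.2)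

lemma xiExponent_le {α l : ℝ} (hα : 0 < α) (hl : 0 ≤ l) :
    xiExponent α l ≤ (α + 1) / α * Real.exp l := by
  refine mul_le_mul_of_nonneg_left ?_ (by positivity)
  calc ∫ u in (0 : ℝ)..1, (Real.exp (l * u) - 1) * ((1 - u) / u)
      ≤ ∫ _ in (0 : ℝ)..1, Real.exp l :=
        intervalIntegral.integral_mono_on zero_le_one (intervalIntegrable_xiIntegrand hl)
          intervalIntegrable_const fun _ hu => xiIntegrand_le hl hu.1 hu.2
    _ = Real.exp l := by simp

lemma integral_exp_mul_one_sub {l : ℝ} (hl : l ≠ 0) :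
    ∫ u in (0 : ℝ)..1, Real.exp (l * u) * (1 - u) = (Real.exp l - 1 - l) / l ^ 2 := by
  rw [intervalIntegral.integral_eq_sub_of_hasDerivAt
    (f := fun u => Real.exp (l * u) * ((1 - u) / l + 1 / l ^ 2))]
  · simp
    field_simp
    ring
  · intro u _
    have h1 : HasDerivAt (fun u : ℝ => Real.exp (l * u)) (Real.exp (l * u) * (l * 1)) u :=
      ((hasDerivAt_id u).const_mul l).exp
    have h2 : HasDerivAt (fun u : ℝ => (1 - u) / l + 1 / l ^ 2) (-1 / l) u :=
      (((hasDerivAt_id u).const_sub 1).div_const l).add_const _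
    refine (h1.mul h2).congr_deriv ?_
    field_simp
    ring
  · exact Continuous.intervalIntegrable (by fun_prop) _ _

lemma hasDerivAt_xiExponent {α l : ℝ} (hl : 0 < l) :
    HasDerivAt (xiExponent α) (xiSlope α l) l := by
  have key := (intervalIntegral.hasDerivAt_integral_of_dominated_loc_of_deriv_le
    (μ := volume) (a := (0 : ℝ)) (b := 1)
    (F := fun l u : ℝ => (Real.exp (l * u) - 1) * ((1 - u) / u))
    (F' := fun l u : ℝ => Real.exp (l * u) * (1 - u)) (x₀ := l) (s := Set.Iio (l + 1))
    (bound := fun _ => Real.exp (l + 1))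
    (Iio_mem_nhds (by linarith)) (Eventually.of_forall fun x => by fun_prop)
    (intervalIntegrable_xiIntegrand hl.le) (by fun_prop) ?_ intervalIntegrable_const ?_).2
  · rw [integral_exp_mul_one_sub hl.ne'] at key
    exact key.const_mul _
  · refine ae_of_all _ fun u hu x hx => ?_
    rw [Set.uIoc_of_le zero_le_one] at hu
    have hx : x < l + 1 := hx
    rw [Real.norm_of_nonneg (mul_nonneg (Real.exp_pos _).le (by linarith [hu.2]))]
    have h1 : Real.exp (x * u) ≤ Real.exp (l + 1) :=
      Real.exp_le_exp.2 (by nlinarith [hu.1, hu.2])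
    nlinarith [hu.1, hu.2, Real.exp_pos (x * u)]
  · refine ae_of_all _ fun u hu x _ => ?_
    rw [Set.uIoc_of_le zero_le_one] at hu
    have h1 : HasDerivAt (fun x : ℝ => Real.exp (x * u)) (Real.exp (x * u) * (1 * u)) x :=
      ((hasDerivAt_id x).mul_const u).exp
    refine ((h1.sub_const 1).mul_const ((1 - u) / u)).congr_deriv ?_
    have := hu.1.ne'
    field_simp

lemma hasDerivAt_xiSlope {α l : ℝ} (hl : l ≠ 0) :
    HasDerivAt (xiSlope α)
      ((α + 1) / α * ((Real.exp l - 1) / l ^ 2 - 2 * (Real.exp l - 1 - l) / l ^ 3)) l := by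
  have h1 : HasDerivAt (fun l : ℝ => Real.exp l - 1 - l) (Real.exp l - 1) l :=
    ((Real.hasDerivAt_exp l).sub_const 1).sub (hasDerivAt_id l)
  have h2 : HasDerivAt (fun l : ℝ => l ^ 2) (2 * l) l := by
    simpa using hasDerivAt_pow 2 l
  refine HasDerivAt.const_mul ((α + 1) / α) ?_
  refine (h1.div h2 (pow_ne_zero 2 hl)).congr_deriv ?_
  field_simp

/-- Makes `exp l - 1 - l` at least half of `exp l`, which yields both the growth of the slope and
the bound on its derivative. -/
lemma two_add_two_mul_le_exp {l : ℝ} (hl : 2 ≤ l) : 2 + 2 * l ≤ Real.exp l := by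
  have h2 : (6 : ℝ) ≤ Real.exp 2 := by
    have := Real.exp_one_gt_d9
    rw [show (2 : ℝ) = 1 + 1 by norm_num, Real.exp_add]
    nlinarith
  have h3 : l - 2 + 1 ≤ Real.exp (l - 2) := Real.add_one_le_exp _
  have h4 : Real.exp l = Real.exp (l - 2) * Real.exp 2 := by rw [← Real.exp_add]; ring_nf
  nlinarith

lemma exp_div_le_xiSlope {α l : ℝ} (hα : 0 < α) (hl : 2 ≤ l) :
    (α + 1) / α * (Real.exp l / (2 * l ^ 2)) ≤ xiSlope α l := by
  refine mul_le_mul_of_nonneg_left ?_ (by positivity)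
  have := two_add_two_mul_le_exp hl
  rw [← div_div]
  gcongr
  linarith

lemma xiSlope_pos {α l : ℝ} (hα : 0 < α) (hl : 2 ≤ l) : 0 < xiSlope α l :=
  lt_of_lt_of_le (by positivity) (exp_div_le_xiSlope hα hl)

lemma deriv_xiSlope_le {α l : ℝ} (hα : 0 < α) (hl : 2 ≤ l) :
    deriv (xiSlope α) l ≤ 2 * xiSlope α l := by
  have h := two_add_two_mul_le_exp hl
  have hl0 : 0 < l := by linarith
  rw [(hasDerivAt_xiSlope hl0.ne').deriv, xiSlope, mul_left_comm]
  refine mul_le_mul_of_nonneg_left ?_ (by positivity)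
  have h1 : 0 ≤ 2 * (Real.exp l - 1 - l) / l ^ 3 := div_nonneg (by linarith) (by positivity)
  have h2 : (Real.exp l - 1) / l ^ 2 ≤ 2 * ((Real.exp l - 1 - l) / l ^ 2) := by
    rw [← mul_div_assoc]
    gcongr
    linarith
  linarith

/-! ### Chernoff bound and exponential tilting -/

namespace IsXiLaw

variable {α : ℝ} {ν : Measure ℝ}

lemma cgf_eq (hν : IsXiLaw α ν) : cgf id ν = xiExponent α := by
  ext l
  rw [cgf, hν.mgf_eq, Real.log_exp]

lemma mem_interior_integrableExpSet (hν : IsXiLaw α ν) (l : ℝ) :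
    l ∈ interior (integrableExpSet id ν) := by
  have : integrableExpSet id ν = Set.univ := Set.eq_univ_of_forall hν.integrable_exp
  simp [this]

/-- Chernoff bound. -/
lemma measureReal_ge_le (hν : IsXiLaw α ν) (hα : 0 < α) {l : ℝ} (hl : 0 ≤ l) (y : ℝ) :
    ν.real {x | y ≤ x} ≤ Real.exp (-l * y + (α + 1) / α * Real.exp l) := by
  have := hν.isProbabilityMeasure
  refine (measure_ge_le_exp_mul_mgf (X := id) y hl (hν.integrable_exp l)).trans ?_
  rw [hν.mgf_eq, ← Real.exp_add]
  gcongr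
  exact xiExponent_le hα hl

lemma integral_tilted (hν : IsXiLaw α ν) {l : ℝ} (hl : 0 < l) :
    ∫ x, x ∂(ν.tilted (l * ·)) = xiSlope α l := by
  have h := integral_tilted_mul_self (hν.mem_interior_integrableExpSet l)
  rw [hν.cgf_eq, (hasDerivAt_xiExponent hl).deriv] at h
  exact h

lemma variance_tilted_le (hν : IsXiLaw α ν) (hα : 0 < α) {l : ℝ} (hl : 2 ≤ l) :
    Var[id; ν.tilted (l * ·)] ≤ 2 * xiSlope α l := by
  have h := variance_tilted_mul (hν.mem_interior_integrableExpSet l)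
  have hev : deriv (xiExponent α) =ᶠ[nhds l] xiSlope α := by
    filter_upwards [Ioi_mem_nhds (show (0 : ℝ) < l by linarith)] with x hx
    exact (hasDerivAt_xiExponent hx).deriv
  rw [hν.cgf_eq, iteratedDeriv_succ, iteratedDeriv_one, hev.deriv_eq] at h
  exact h.trans_le (deriv_xiSlope_le hα hl)

/-- Lower tail bound by exponential tilting: the tilted law concentrates around
`xiSlope α l`. -/
lemma le_measureReal_gt (hν : IsXiLaw α ν) (hα : 0 < α) {l δ : ℝ} (hl : 2 ≤ l) (hδ : 0 < δ) :
    Real.exp (-(l * ((1 + δ) * xiSlope α l))) * (1 - 2 / (δ ^ 2 * xiSlope α l))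
      ≤ ν.real {x | (1 - δ) * xiSlope α l < x} := by
  have := hν.isProbabilityMeasure
  set m := xiSlope α l with hm
  have hm0 : 0 < m := xiSlope_pos hα hl
  have hQ : IsProbabilityMeasure (ν.tilted (l * ·)) :=
    isProbabilityMeasure_tilted (hν.integrable_exp l)
  have hcheb : (ν.tilted (l * ·)).real {x | δ * m ≤ |x - m|} ≤ 2 / (δ ^ 2 * m) := by
    have h := meas_ge_le_variance_div_sq (μ := ν.tilted (l * ·)) (X := id)
      (memLp_tilted_mul (hν.mem_interior_integrableExpSet l) 2) (c := δ * m) (by positivity)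
    simp only [id] at h
    rw [hν.integral_tilted (by linarith)] at h
    refine (ENNReal.toReal_mono ENNReal.ofReal_ne_top h).trans ?_
    rw [ENNReal.toReal_ofReal (div_nonneg (variance_nonneg _ _) (by positivity))]
    calc _ ≤ 2 * m / (δ * m) ^ 2 := by
          gcongr
          exact hν.variance_tilted_le hα hl
      _ = 2 / (δ ^ 2 * m) := by field_simp
  set A : Set ℝ := {x | |x - m| < δ * m} with hA
  have hAm : MeasurableSet A := measurableSet_lt (by fun_prop) (by fun_prop)
  have hAc : {x : ℝ | δ * m ≤ |x - m|} = Aᶜ := by ext x; simp [hA]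
  rw [hAc, probReal_compl_eq_one_sub hAm] at hcheb
  -- On `A` the tilted density is at most `exp (l * x)` with `x < (1 + δ) * m`: the normalising
  -- constant is at least 1 because the exponent is nonnegative.
  have htilt : (ν.tilted (l * ·)).real A ≤ Real.exp (l * ((1 + δ) * m)) * ν.real A := by
    have h := tilted_mul_apply_eq_ofReal_integral_mgf (μ := ν) (X := id) (t := l) A
    have h0 : 0 ≤ ∫ a in A, Real.exp (l * id a) / mgf id ν l ∂ν :=
      integral_nonneg fun a => div_nonneg (Real.exp_pos _).le mgf_nonneg
    have h1 : (ν.tilted (l * ·)).real A = ∫ a in A, Real.exp (l * id a) / mgf id ν l ∂ν := by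
      rw [← ENNReal.toReal_ofReal h0, ← h]
      rfl
    rw [h1]
    calc ∫ a in A, Real.exp (l * id a) / mgf id ν l ∂ν
        ≤ ∫ _ in A, Real.exp (l * ((1 + δ) * m)) ∂ν := by
          refine setIntegral_mono_on ((hν.integrable_exp l).div_const _).integrableOn
            (integrable_const _) hAm fun x hx => ?_
          have hx : x - m < δ * m := (abs_lt.1 hx).2
          rw [hν.mgf_eq]
          refine (div_le_self (Real.exp_pos _).le
            (Real.one_le_exp (xiExponent_nonneg hα (by linarith)))).trans ?_
          rw [Real.exp_le_exp, id]
          exact mul_le_mul_of_nonneg_left (by linarith) (by linarith)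
      _ = _ := by simp [mul_comm, Measure.real]
  have hsub : ν.real A ≤ ν.real {x | (1 - δ) * m < x} := by
    refine measureReal_mono fun x hx => ?_
    have := (abs_lt.1 (show |x - m| < δ * m from hx)).1
    show (1 - δ) * m < x
    linarith
  refine le_trans ?_ hsub
  rw [Real.exp_neg, inv_mul_le_iff₀ (Real.exp_pos _)]
  linarith

end IsXiLaw

/-! ### Tails at the scale log n / log log n -/

lemma tendsto_neg_mul_add_mul_rpow_atBot {a b C : ℝ} (ha : 0 < a) (hb : b < 1) :
    Tendsto (fun x : ℝ => -(a * x) + C * x ^ b) atTop atBot := by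
  have h1 : Tendsto (fun x : ℝ => x ^ (-(1 - b))) atTop (nhds 0) :=
    tendsto_rpow_neg_atTop (by linarith)
  have h2 : Tendsto (fun x : ℝ => -a + C * x ^ (-(1 - b))) atTop (nhds (-a)) := by
    simpa using (h1.const_mul C).const_add (-a)
  refine (tendsto_id.atTop_mul_neg (by linarith) h2).congr' ?_
  filter_upwards [eventually_gt_atTop 0] with x hx
  have : x ^ b = x * x ^ (-(1 - b)) := by
    nth_rewrite 2 [← Real.rpow_one x]
    rw [← Real.rpow_add hx]
    ring_nf
  rw [id, this]
  ring

lemma tendsto_log_natCast_atTop : Tendsto (fun n : ℕ => Real.log n) atTop atTop :=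
  Real.tendsto_log_atTop.comp tendsto_natCast_atTop_atTop

lemma tendsto_div_log_atTop : Tendsto (fun x : ℝ => x / Real.log x) atTop atTop := by
  have h : Tendsto (fun s : ℝ => Real.exp s / s) atTop atTop := by
    simpa using Real.tendsto_exp_div_pow_atTop 1
  refine (h.comp Real.tendsto_log_atTop).congr' ?_
  filter_upwards [eventually_gt_atTop 0] with x hx
  simp [Real.exp_log hx]

lemma continuousOn_xiSlope {α : ℝ} : ContinuousOn (xiSlope α) (Set.Ioi 0) := fun _ hx =>
  (hasDerivAt_xiSlope (ne_of_gt hx)).continuousAt.continuousWithinAt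

/-- The slope reaches the level `κ x / log x` before `(1 + η) log x`. -/
lemma eventually_exists_xiSlope_eq {α κ η : ℝ} (hα : 0 < α) (hκ : 0 < κ) (hη : 0 < η) :
    ∀ᶠ x : ℝ in atTop, ∃ l, 2 ≤ l ∧ l ≤ (1 + η) * Real.log x ∧
      xiSlope α l = κ * (x / Real.log x) := by
  have hgrow : Tendsto (fun x : ℝ => Real.exp (η * Real.log x) / Real.log x) atTop atTop := by
    have h : Tendsto (fun t : ℝ => η * (Real.exp t / t)) atTop atTop :=
      Tendsto.const_mul_atTop hη (by simpa using Real.tendsto_exp_div_pow_atTop 1)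
    refine (h.comp (Real.tendsto_log_atTop.const_mul_atTop hη)).congr fun x => ?_
    simp only [Function.comp]
    rw [← mul_div_assoc, mul_div_mul_left _ _ hη.ne']
  filter_upwards [(tendsto_div_log_atTop.const_mul_atTop hκ).eventually_ge_atTop (xiSlope α 2),
    hgrow.eventually_ge_atTop (κ * (2 * (1 + η) ^ 2) / ((α + 1) / α)),
    Real.tendsto_log_atTop.eventually_ge_atTop 2, eventually_gt_atTop 0] with x h1 h2 h3 hx
  have hs : 0 < Real.log x := by linarith
  have h4 : 2 ≤ (1 + η) * Real.log x := by nlinarith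
  -- At `l = (1 + η) * log x`, `exp l` is `x` times `exp (η * log x)`; this surplus absorbs the `l ^
  -- 2` in the lower bound for the slope.
  have h5 : κ * (x / Real.log x) ≤ xiSlope α ((1 + η) * Real.log x) := by
    refine le_trans ?_ (exp_div_le_xiSlope hα h4)
    rw [div_le_iff₀ (by positivity)] at h2
    have hexp : Real.exp ((1 + η) * Real.log x) = x * Real.exp (η * Real.log x) := by
      rw [add_mul, one_mul, Real.exp_add, Real.exp_log hx]
    calc κ * (x / Real.log x)
        = κ * (2 * (1 + η) ^ 2) * (x / (2 * (1 + η) ^ 2 * Real.log x)) := by field_simp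
      _ ≤ Real.exp (η * Real.log x) / Real.log x * ((α + 1) / α) *
            (x / (2 * (1 + η) ^ 2 * Real.log x)) := by gcongr
      _ = _ := by rw [hexp]; field_simp
  obtain ⟨l, hl, hle⟩ := intermediate_value_Icc h4
    (continuousOn_xiSlope.mono fun y hy => lt_of_lt_of_le two_pos hy.1) ⟨h1, h5⟩
  exact ⟨l, hl.1, hl.2, hle⟩

namespace IsXiLaw

variable {α : ℝ} {ν : Measure ℝ}

lemma tendsto_mul_measureReal_ge (hν : IsXiLaw α ν) (hα : 0 < α) {ε : ℝ} (hε : 0 < ε) :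
    Tendsto (fun n : ℕ =>
      n * ν.real {x | (1 + ε) * (Real.log n / Real.log (Real.log n)) ≤ x}) atTop (nhds 0) := by
  -- The Chernoff parameter is `l = b * log log n`: then `l * y = (1 + ε / 2) * log n`, while `exp l
  -- = (log n) ^ b` is of lower order since `b < 1`.
  set b : ℝ := (1 + ε / 2) / (1 + ε) with hb
  have hb0 : 0 ≤ b := by positivity
  have hb1 : b < 1 := (div_lt_one (by positivity)).2 (by linarith)
  have hlim := Real.tendsto_exp_atBot.comp ((tendsto_neg_mul_add_mul_rpow_atBot
    (a := ε / 2) (C := (α + 1) / α) (by positivity) hb1).comp tendsto_log_natCast_atTop)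
  refine squeeze_zero' (Eventually.of_forall fun n => by positivity) ?_ hlim
  filter_upwards [tendsto_log_natCast_atTop.eventually_gt_atTop 1, eventually_gt_atTop 0]
    with n hL hn
  have hLL : 0 < Real.log (Real.log n) := Real.log_pos hL
  have hn' : (0 : ℝ) < n := by exact_mod_cast hn
  have h := hν.measureReal_ge_le hα (mul_nonneg hb0 hLL.le)
    ((1 + ε) * (Real.log n / Real.log (Real.log n)))
  refine (mul_le_mul_of_nonneg_left h hn'.le).trans_eq ?_
  nth_rewrite 1 [← Real.exp_log hn']
  rw [← Real.exp_add, mul_comm b, ← Real.rpow_def_of_pos (by linarith)]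
  simp only [Function.comp]
  congr 1
  rw [hb]
  field_simp
  ring

lemma tendsto_mul_measureReal_gt (hν : IsXiLaw α ν) (hα : 0 < α) {ε : ℝ} (hε : 0 < ε)
    (hε1 : ε < 1) :
    Tendsto (fun n : ℕ =>
      n * ν.real {x | (1 - ε) * (Real.log n / Real.log (Real.log n)) < x}) atTop atTop := by
  -- The tilted mean is `κ * x`, with `κ` chosen so that the window's lower edge is `(1 - ε) * x`.
  -- In `θ` one factor `1 + δ` is the window's upper edge, the other the bound on `l`; `δ = ε / 4`
  -- gives `θ < 1`, as `(1 + δ)² (1 - 4δ) < 1 - δ`.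
  set δ : ℝ := ε / 4 with hδ
  have hδ0 : 0 < δ := by positivity
  have hδ1 : 0 < 1 - δ := by linarith
  set κ : ℝ := (1 - ε) / (1 - δ) with hκ
  have hκ0 : 0 < κ := div_pos (by linarith) hδ1
  have hκδ : (1 - δ) * κ = 1 - ε := by rw [hκ]; field_simp
  set θ : ℝ := (1 + δ) * ((1 + δ) * κ) with hθ
  have hθ1 : θ < 1 := by
    have : θ * (1 - δ) = (1 + δ) ^ 2 * (1 - ε) := by rw [← hκδ, hθ]; ring
    have h4 : ε = 4 * δ := by rw [hδ]; ring
    have : θ * (1 - δ) < 1 * (1 - δ) := by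
      rw [this, h4]
      nlinarith [pow_pos hδ0 2, pow_pos hδ0 3]
    exact lt_of_mul_lt_mul_right this hδ1.le
  have hlim : Tendsto (fun n : ℕ => Real.exp ((1 - θ) * Real.log n) * (1 / 2)) atTop atTop :=
    (Real.tendsto_exp_atTop.comp
      (tendsto_log_natCast_atTop.const_mul_atTop (by linarith))).atTop_mul_const (by norm_num)
  refine tendsto_atTop_mono' _ ?_ hlim
  filter_upwards [tendsto_log_natCast_atTop.eventually
      (eventually_exists_xiSlope_eq hα hκ0 hδ0),
    (tendsto_div_log_atTop.comp tendsto_log_natCast_atTop).eventually_ge_atTop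
      (4 / (δ ^ 2 * κ)), tendsto_log_natCast_atTop.eventually_gt_atTop 1,
    eventually_gt_atTop 0] with n ⟨l, hl2, hl, hslope⟩ hbig hL hn
  simp only [Function.comp] at hbig
  have hLL : 0 < Real.log (Real.log n) := Real.log_pos hL
  have hn' : (0 : ℝ) < n := by exact_mod_cast hn
  have h := hν.le_measureReal_gt hα hl2 hδ0
  rw [hslope, ← mul_assoc (1 - δ), hκδ] at h
  refine le_trans ?_ (mul_le_mul_of_nonneg_left h hn'.le)
  have hexp : l * ((1 + δ) * (κ * (Real.log n / Real.log (Real.log n)))) ≤ θ * Real.log n := by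
    calc l * ((1 + δ) * (κ * (Real.log n / Real.log (Real.log n))))
        ≤ (1 + δ) * Real.log (Real.log n) *
          ((1 + δ) * (κ * (Real.log n / Real.log (Real.log n)))) := by gcongr
      _ = θ * Real.log n := by rw [hθ]; field_simp
  have hhalf : 1 / 2 ≤ 1 - 2 / (δ ^ 2 * (κ * (Real.log n / Real.log (Real.log n)))) := by
    rw [div_le_iff₀ (by positivity)] at hbig
    have : 2 / (δ ^ 2 * (κ * (Real.log n / Real.log (Real.log n)))) ≤ 1 / 2 := by
      rw [div_le_div_iff₀ (by positivity) (by norm_num)]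
      linarith
    linarith
  calc Real.exp ((1 - θ) * Real.log n) * (1 / 2)
      = n * (Real.exp (-(θ * Real.log n)) * (1 / 2)) := by
        rw [sub_mul, one_mul, sub_eq_add_neg, Real.exp_add, Real.exp_log hn', mul_assoc]
    _ ≤ _ := by gcongr

end IsXiLaw

/-! ### From one-variable tails to the maximum -/

section Maximum

variable {Ω : Type*} [MeasurableSpace Ω] {μ : Measure Ω} [IsProbabilityMeasure μ] {ν : Measure ℝ}

/-- Union bound. It needs `0 < n`: an empty real supremum is 0 by default, so at `n = 0` and `y ≤ 0`
the left side would be 1 and the right side 0. -/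
lemma measureReal_le_iSup_le {n : ℕ} (hn : 0 < n) {X : Fin n → Ω → ℝ}
    (hlaw : ∀ i, HasLaw (X i) ν μ) (y : ℝ) :
    μ.real {ω | y ≤ ⨆ i, X i ω} ≤ n * ν.real {x | y ≤ x} := by
  have : Nonempty (Fin n) := ⟨⟨0, hn⟩⟩
  calc μ.real {ω | y ≤ ⨆ i, X i ω} ≤ μ.real (⋃ i, {ω | y ≤ X i ω}) := by
        refine measureReal_mono fun ω hω => ?_
        obtain ⟨i, hi⟩ := exists_eq_ciSup_of_finite (f := fun i => X i ω)
        exact Set.mem_iUnion.2 ⟨i, hω.trans_eq hi.symm⟩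
    _ ≤ ∑ i, μ.real {ω | y ≤ X i ω} := measureReal_iUnion_fintype_le _
    _ = n * ν.real {x | y ≤ x} := by
        simp_rw [fun i => (hlaw i).measureReal_eq (p := fun x => y ≤ x) measurableSet_Ici]
        simp

lemma measureReal_iSup_le_le {n : ℕ} {X : Fin n → Ω → ℝ} [IsProbabilityMeasure ν]
    (hlaw : ∀ i, HasLaw (X i) ν μ) (hindep : iIndepFun X μ) (y : ℝ) :
    μ.real {ω | ⨆ i, X i ω ≤ y} ≤ Real.exp (-(n * ν.real {x | y < x})) := by
  have hset : {x : ℝ | x ≤ y} = {x | y < x}ᶜ := by ext x; simp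
  calc μ.real {ω | ⨆ i, X i ω ≤ y} ≤ μ.real (⋂ i ∈ Finset.univ, X i ⁻¹' {x | x ≤ y}) := by
        refine measureReal_mono fun ω hω => ?_
        simp only [Finset.mem_univ, Set.iInter_true, Set.mem_iInter]
        exact fun i => (le_ciSup (Set.finite_range fun i => X i ω).bddAbove i).trans hω
    _ = ∏ i, μ.real {ω | X i ω ≤ y} := by
        rw [Measure.real, hindep.measure_inter_preimage_eq_mul Finset.univ
          (sets := fun _ => {x | x ≤ y}) (fun i _ => measurableSet_Iic), ENNReal.toReal_prod]
        rfl
    _ = (1 - ν.real {x | y < x}) ^ n := by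
        simp_rw [fun i => (hlaw i).measureReal_eq (p := fun x => x ≤ y) measurableSet_Iic]
        rw [hset, probReal_compl_eq_one_sub (s := {x | y < x}) measurableSet_Ioi]
        simp
    _ ≤ Real.exp (-ν.real {x | y < x}) ^ n := by
        have := measureReal_le_one (μ := ν) (s := {x | y < x})
        exact pow_le_pow_left₀ (by linarith) (Real.one_sub_le_exp_neg _) n
    _ = _ := by rw [← Real.exp_nat_mul]; ring_nf

end Maximum

theorem mainTheorem6 (α : ℝ) (hα : 0 < α) (ν : Measure ℝ) (hν : IsXiLaw α ν)
    {Ω : Type*} [MeasurableSpace Ω] (μ : Measure Ω) [IsProbabilityMeasure μ]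
    (ξ : (n : ℕ) → Fin n → Ω → ℝ)
    (hlaw : ∀ (n : ℕ) (i : Fin n), HasLaw (ξ n i) ν μ)
    (hindep : ∀ n : ℕ, iIndepFun (ξ n) μ) :
    TendstoInMeasure μ
      (fun (n : ℕ) (ω : Ω) =>
        (⨆ i : Fin n, ξ n i ω) * Real.log (Real.log n) / Real.log n)
      atTop (fun _ => (1 : ℝ)) := by
  have := hν.isProbabilityMeasure
  rw [tendstoInMeasure_iff_measureReal_dist]
  intro ε hε
  -- Shrinking ε only enlarges the deviation event, and the lower tail estimate requires a value
  -- below 1.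
  set ε' : ℝ := min ε (1 / 2) with hε'
  have hε'0 : 0 < ε' := by positivity
  have hε'1 : ε' < 1 := (min_le_right _ _).trans_lt (by norm_num)
  have hup := hν.tendsto_mul_measureReal_ge hα hε'0
  have hlow := Real.tendsto_exp_atBot.comp
    (tendsto_neg_atTop_atBot.comp (hν.tendsto_mul_measureReal_gt hα hε'0 hε'1))
  refine squeeze_zero' (Eventually.of_forall fun n => measureReal_nonneg) ?_
    (by simpa using hup.add hlow)
  filter_upwards [tendsto_log_natCast_atTop.eventually_gt_atTop 1, eventually_gt_atTop 0]
    with n hL hn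
  have hLL : 0 < Real.log (Real.log n) := Real.log_pos hL
  have hL0 : 0 < Real.log n := by linarith
  refine le_trans (le_trans (measureReal_mono ?_) (measureReal_union_le _ _)) (add_le_add
    (measureReal_le_iSup_le hn (hlaw n) ((1 + ε') * (Real.log n / Real.log (Real.log n))))
    (measureReal_iSup_le_le (hlaw n) (hindep n)
      ((1 - ε') * (Real.log n / Real.log (Real.log n)))))
  intro ω hω
  have hω : ε' ≤ |(⨆ i : Fin n, ξ n i ω) * Real.log (Real.log n) / Real.log n - 1| :=
    (min_le_left _ _).trans hω
  rcases le_abs.1 hω with h | h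
  · left
    have h : 1 + ε' ≤ (⨆ i : Fin n, ξ n i ω) * Real.log (Real.log n) / Real.log n := by linarith
    rw [le_div_iff₀ hL0] at h
    show (1 + ε') * (Real.log n / Real.log (Real.log n)) ≤ ⨆ i : Fin n, ξ n i ω
    rwa [← mul_div_assoc, div_le_iff₀ hLL]
  · right
    have h : (⨆ i : Fin n, ξ n i ω) * Real.log (Real.log n) / Real.log n ≤ 1 - ε' := by linarith
    rw [div_le_iff₀ hL0] at h
    show ⨆ i : Fin n, ξ n i ω ≤ (1 - ε') * (Real.log n / Real.log (Real.log n))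
    rwa [← mul_div_assoc, le_div_iff₀ hLL]
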